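/- A sequence $c=(c_n)_{n\ge 1}$ of complex numbers is called higher order oscillating if for every $k\ge 1$ it is oscillating of order $k$, that is, $\sum_{n=1}^N|c_n|^{\lambda}=O(N)$ for some real $\lambda\ge 1$, and $\frac1N\sum_{n=1}^N c_n e^{2\pi i P(n)}\to 0$ as $N\to\infty$ for every real polynomial $P$ of degree at most $k$. The sequence $c$ is orthogonal to a topological dynamical system $(X,T)$ ($X$ compact Hausdorff, $T:X\to X$ continuous) if $\frac1N\sum_{n=1}^N c_n f(T^n x)\to 0$ for every continuous $f:X\to\mathbb C$ and every $x\in X$. **Theorem.** There exist a homeomorphism $T$ of a compact Hausdorff space $X$ with topological entropy zero and a higher order oscillating sequence which is not orthogonal to $(X,T)$. More precisely, let $c=(c_n)_{n\ge 0}$ be either the Thue–Morse sequence $c_n=(-1)^{s_2(n)}$, where $s_2(n)$ is the sum of the binary digits of $n$, or the Rudin–Shapiro sequence $c_n=(-1)^{u_{11}(n)}$, where $u_{11}(n)$ is the number of (possibly overlapping) occurrences of the block $11$ in the binary expansion of $n$. Then $c$ is higher order oscillating, and: 1. Let $X_c\subset\{-1,1\}^{\mathbb Z}$ be the two-sided subshift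 generated by $c$, i.e. the set of bi-infinite sequences all of whose finite words occur in $c$, with the shift homeomorphism $(Sx)_j=x_{j+1}$. Then $(X_c,S)$ has topological entropy zero, $c$ is not orthogonal to $(X_c,S)$, and there is $y\in X_c$ with $y_n=c_n$ for all $n\ge 0$ such that, for the coordinate projection $\pi_0(x)=x_0$, $\frac1N\sum_{n=1}^N c_n\,\pi_0(S^n y)\to 1$. 2. Let $X_c^+\subset\{-1,1\}^{\mathbb N}$ be the closure of the orbit of $c$ under the one-sided shift $(\sigma x)_n=x_{n+1}$. Then $(X_c^+,\sigma)$ has topological entropy zero, $c$ is not orthogonal to $(X_c^+,\sigma)$, and $\frac1N\sum_{n=1}^N c_n\,\pi_0(\sigma^n c)\to 1$. -/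

import Mathlib

open Filter Topology

/-! ### Oscillating sequences, entropy, orthogonality -/

/-- `c` is oscillating of order `k`: for some real `p ≥ 1` one has
`∑_{n=1}^N |c n| ^ p = O(N)`, and for every real polynomial `P` of degree at most `k` the averages
`(1/N) ∑_{n=1}^N c n * exp (2 π i P(n))` tend to `0`. -/
def IsOscillating (k : ℕ) (c : ℕ → ℂ) : Prop :=
  (∃ p : ℝ, 1 ≤ p ∧
    (fun N : ℕ => ∑ n ∈ Finset.Icc 1 N, ‖c n‖ ^ p) =O[atTop] (fun N : ℕ => (N : ℝ))) ∧
  ∀ P : Polynomial ℝ, P.natDegree ≤ k →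
    Tendsto (fun N : ℕ => (1 / (N : ℂ)) * ∑ n ∈ Finset.Icc 1 N,
      c n * Complex.exp (2 * Real.pi * Complex.I * ((P.eval (n : ℝ) : ℝ) : ℂ))) atTop (𝓝 0)

/-- Higher order oscillating sequences: oscillating of every order `k ≥ 1`. -/
def IsHigherOrderOscillating (c : ℕ → ℂ) : Prop :=
  ∀ k : ℕ, 1 ≤ k → IsOscillating k c

/-- Topological entropy (Bowen–Dinaburg) of a self-map of a compact space. The uniform structure of
a compact Hausdorff space is determined by its topology. -/
noncomputable def topologicalEntropy {X : Type*} [UniformSpace X] [CompactSpace X]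
    (T : X → X) : EReal :=
  Dynamics.coverEntropy T Set.univ

/-- The averages `(1/N) ∑_{n=1}^N c n * f (T^n x)`. -/
noncomputable def correlationAverage {X : Type*} (c : ℕ → ℂ) (T : X → X) (f : X → ℂ) (x : X)
    (N : ℕ) : ℂ :=
  (1 / (N : ℂ)) * ∑ n ∈ Finset.Icc 1 N, c n * f (T^[n] x)

/-- The sequence `c` is orthogonal to the topological dynamical system `(X, T)`. -/
def IsOrthogonalToSystem {X : Type*} [TopologicalSpace X] (c : ℕ → ℂ) (T : X → X) : Prop :=
  ∀ (f : C(X, ℂ)) (x : X), Tendsto (correlationAverage c T f x) atTop (𝓝 0)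

/-! ### Subshifts generated by a one-sided sequence -/

section Subshifts

variable {A : Type*}

/-- The two-sided subshift generated by `c : ℕ → A`: all bi-infinite sequences each of whose
finite words occurs in `c`. -/
def twoSidedSubshift (c : ℕ → A) : Set (ℤ → A) :=
  {x | ∀ (a : ℤ) (L : ℕ), ∃ m : ℕ, ∀ i < L, x (a + (i : ℤ)) = c (m + i)}

theorem twoSidedSubshift_translate {c : ℕ → A} {x : ℤ → A} (hx : x ∈ twoSidedSubshift c) (b : ℤ) :
    (fun j => x (j + b)) ∈ twoSidedSubshift c := by
  intro a L
  obtain ⟨m, hm⟩ := hx (a + b) L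
  refine ⟨m, fun i hi => ?_⟩
  rw [← hm i hi]
  exact congrArg x (by ring)

theorem isClosed_twoSidedSubshift [TopologicalSpace A] [DiscreteTopology A] (c : ℕ → A) :
    IsClosed (twoSidedSubshift c) := by
  have h : twoSidedSubshift c = ⋂ (a : ℤ) (L : ℕ),
      (fun (x : ℤ → A) (i : Fin L) => x (a + ((i : ℕ) : ℤ))) ⁻¹'
        {w | ∃ m : ℕ, ∀ i : Fin L, w i = c (m + i)} := by
    ext x
    simp only [twoSidedSubshift, Set.mem_iInter, Set.mem_preimage, Set.mem_ofPred_eq]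
    exact ⟨fun hx a L => (hx a L).imp fun m hm i => hm i i.2,
      fun hx a L => (hx a L).imp fun m hm i hi => hm ⟨i, hi⟩⟩
  rw [h]
  refine isClosed_iInter fun a => isClosed_iInter fun L => ?_
  exact (isClosed_discrete _).preimage (by fun_prop)

instance [TopologicalSpace A] [DiscreteTopology A] [CompactSpace A] (c : ℕ → A) :
    CompactSpace (twoSidedSubshift c) :=
  isCompact_iff_compactSpace.mp (isClosed_twoSidedSubshift c).isCompact

/-- The shift homeomorphism `(S x) j = x (j + 1)` of the two-sided subshift generated by `c`. -/
def twoSidedShift [TopologicalSpace A] (c : ℕ → A) : twoSidedSubshift c ≃ₜ twoSidedSubshift c where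
  toFun x := ⟨fun j => x.1 (j + 1), twoSidedSubshift_translate x.2 1⟩
  invFun x := ⟨fun j => x.1 (j + (-1)), twoSidedSubshift_translate x.2 (-1)⟩
  left_inv x := Subtype.ext (funext fun j => congrArg x.1 (by ring))
  right_inv x := Subtype.ext (funext fun j => congrArg x.1 (by ring))
  continuous_toFun := Continuous.subtype_mk
    (f := fun (x : twoSidedSubshift c) (j : ℤ) => x.1 (j + 1))
    (continuous_pi fun j => (continuous_apply (A := fun _ : ℤ => A) (j + 1)).comp
      continuous_subtype_val) _
  continuous_invFun := Continuous.subtype_mk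
    (f := fun (x : twoSidedSubshift c) (j : ℤ) => x.1 (j + (-1)))
    (continuous_pi fun j => (continuous_apply (A := fun _ : ℤ => A) (j + (-1))).comp
      continuous_subtype_val) _

/-- The one-sided shift `(σ x) n = x (n + 1)` on the full shift. -/
def fullShiftMap (x : ℕ → A) : ℕ → A := fun n => x (n + 1)

/-- The one-sided subshift generated by `c`: the closure of the orbit of `c` under the shift. -/
def oneSidedSubshift [TopologicalSpace A] (c : ℕ → A) : Set (ℕ → A) :=
  closure (Set.range fun n : ℕ => fullShiftMap^[n] c)

theorem mapsTo_fullShiftMap [TopologicalSpace A] (c : ℕ → A) :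
    Set.MapsTo fullShiftMap (oneSidedSubshift c) (oneSidedSubshift c) := by
  refine Set.MapsTo.closure ?_ (by unfold fullShiftMap; fun_prop)
  rintro _ ⟨n, rfl⟩
  exact ⟨n + 1, Function.iterate_succ_apply' _ _ _⟩

instance [TopologicalSpace A] [CompactSpace A] (c : ℕ → A) : CompactSpace (oneSidedSubshift c) :=
  isCompact_iff_compactSpace.mp isClosed_closure.isCompact

/-- The shift map of the one-sided subshift generated by `c`. -/
def oneSidedShift [TopologicalSpace A] (c : ℕ → A) : oneSidedSubshift c → oneSidedSubshift c :=
  (mapsTo_fullShiftMap c).restrict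

/-- The sequence `c` as a point of the one-sided subshift it generates. -/
def ownPoint [TopologicalSpace A] (c : ℕ → A) : oneSidedSubshift c :=
  ⟨c, subset_closure ⟨0, rfl⟩⟩

end Subshifts

/-! ### The Thue–Morse and Rudin–Shapiro sequences -/

/-- The alphabet `{-1, 1}`, a two-point discrete space. -/
abbrev PlusMinusOne : Type := ({-1, 1} : Set ℂ)

/-- `(-1)^k` as a letter. -/
def signPow (k : ℕ) : PlusMinusOne :=
  ⟨(-1) ^ k, (neg_one_pow_eq_or ℂ k).symm⟩

/-- Thue–Morse: `(-1)^{s(n)}` with `s(n)` the sum of the binary digits of `n`. -/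
def thueMorse (n : ℕ) : PlusMinusOne :=
  signPow (Nat.digits 2 n).sum

/-- The number of (possibly overlapping) occurrences of `11` in the binary expansion of `n`. -/
def countOneOne (n : ℕ) : ℕ :=
  ((Nat.digits 2 n).zip (Nat.digits 2 n).tail).count (1, 1)

/-- Rudin–Shapiro: `(-1)^{u(n)}` with `u(n)` the number of `11` in the binary expansion of `n`. -/
def rudinShapiro (n : ℕ) : PlusMinusOne :=
  signPow (countOneOne n)

/-!
Thue–Morse and Rudin–Shapiro are both *block-multiplicative* (`IsBlockMultiplicative`): writing
`n = 2 ^ m * a + b` with `b < 2 ^ m`, one has `c n = ± c (2 ^ m * (a % 2) + b)` with a sign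
depending only on `a`. All claims follow from this property and the values `c 0 = c 10 = 1`, except
for orthogonality to linear phases, which is shown for each sequence separately.

*Oscillation.* For a linear phase it suffices to bound the exponential sums over the two types of
dyadic blocks: for Thue–Morse they are products of factors `1 - z ^ 2 ^ j`, two consecutive ones of
which are bounded by `16 / 5 < 4`, and for Rudin–Shapiro the parallelogram law yields square-root
cancellation. For a polynomial `P` with an irrational coefficient of index at least `2`, van der
Corput's difference theorem reduces the claim to the sequences `c (n + d) * c n` times the phase of
`P (n + d) - P n`, which still has an irrational non-constant coefficient. The block structure makes
`c (n + d) * c n` periodic with period `2 ^ (m + 1)` outside a set of density `d / 2 ^ m`, so that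
Weyl's theorem (`meanZero_phase_polynomial`) applies after expanding the periodic factor in
characters (`MeanZero.mul_periodic`). If all coefficients of index at least `2` are rational, then
the phase of `P` is a linear phase times a periodic sequence, and the linear case suffices.

*Entropy.* A word of length at most `2 ^ m` meets at most two consecutive blocks, so there are only
`O (2 ^ m)` such words. Linear complexity forces the entropy of both subshifts to vanish
(`topologicalEntropy_eq_zero`).

*Correlation.* Each initial word of `c` recurs arbitrarily far to the right, so by compactness `c`
extends to a point `y` of the two-sided subshift. Along the orbits of `y` and of `c` the coordinate
projection reproduces `c`, and `c n * c n = 1`.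
-/

/-! ### Sequences with vanishing mean -/

/-- The Cesàro means of `f` tend to `0`. -/
def MeanZero (f : ℕ → ℂ) : Prop :=
  Tendsto (fun N : ℕ => (∑ n ∈ Finset.range N, f n) / N) atTop (𝓝 0)

theorem meanZero_iff {f : ℕ → ℂ} :
    MeanZero f ↔ ∀ ε : ℝ, 0 < ε → ∀ᶠ N : ℕ in atTop, ‖∑ n ∈ Finset.range N, f n‖ ≤ ε * N := by
  unfold MeanZero
  rw [Metric.tendsto_nhds]
  constructor
  · intro h ε hε
    filter_upwards [h ε hε, eventually_gt_atTop 0] with N hN hpos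
    have hN' : (0 : ℝ) < N := by exact_mod_cast hpos
    rw [dist_zero_right, norm_div, Complex.norm_natCast, div_lt_iff₀ hN'] at hN
    exact hN.le
  · intro h ε hε
    filter_upwards [h (ε / 2) (by positivity), eventually_gt_atTop 0] with N hN hpos
    have hN' : (0 : ℝ) < N := by exact_mod_cast hpos
    rw [dist_zero_right, norm_div, Complex.norm_natCast, div_lt_iff₀ hN']
    nlinarith

theorem MeanZero.of_approx {f : ℕ → ℂ}
    (h : ∀ ε : ℝ, 0 < ε → ∃ g, MeanZero g ∧ ∃ C : ℝ, ∀ N : ℕ,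
      ‖∑ n ∈ Finset.range N, (f n - g n)‖ ≤ ε * N + C) : MeanZero f := by
  rw [meanZero_iff]
  intro ε hε
  obtain ⟨g, hg, C, hC⟩ := h (ε / 4) (by positivity)
  have hlim : Tendsto (fun N : ℕ => ε / 4 * (N : ℝ)) atTop atTop :=
    tendsto_natCast_atTop_atTop.const_mul_atTop (by positivity)
  filter_upwards [meanZero_iff.1 hg (ε / 4) (by positivity), hlim.eventually_ge_atTop C]
    with N h1 h2
  have h3 : ∑ n ∈ Finset.range N, f n
      = ∑ n ∈ Finset.range N, (f n - g n) + ∑ n ∈ Finset.range N, g n := by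
    rw [← Finset.sum_add_distrib]; simp
  rw [h3]
  have := norm_add_le (∑ n ∈ Finset.range N, (f n - g n)) (∑ n ∈ Finset.range N, g n)
  have := hC N
  have : 0 ≤ ε * N := by positivity
  linarith

theorem MeanZero.zero : MeanZero (fun _ => 0) := by simp [MeanZero]

theorem MeanZero.add {f g : ℕ → ℂ} (hf : MeanZero f) (hg : MeanZero g) :
    MeanZero (fun n => f n + g n) := by
  have := Tendsto.add hf hg
  simpa [MeanZero, Finset.sum_add_distrib, add_div] using this

theorem MeanZero.const_mul {f : ℕ → ℂ} (a : ℂ) (hf : MeanZero f) :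
    MeanZero (fun n => a * f n) := by
  have := Tendsto.const_mul a hf
  simpa [MeanZero, ← Finset.mul_sum, mul_div_assoc] using this

theorem MeanZero.sum {ι : Type*} {s : Finset ι} {f : ι → ℕ → ℂ} (h : ∀ i ∈ s, MeanZero (f i)) :
    MeanZero (fun n => ∑ i ∈ s, f i n) := by
  classical
  induction s using Finset.induction_on with
  | empty => simpa using MeanZero.zero
  | insert a s ha ih =>
    simp only [Finset.sum_insert ha]
    exact (h a (Finset.mem_insert_self a s)).add
      (ih fun i hi => h i (Finset.mem_insert_of_mem hi))

theorem MeanZero.conj {f : ℕ → ℂ} (hf : MeanZero f) :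
    MeanZero (fun n => (starRingEnd ℂ) (f n)) := by
  rw [meanZero_iff] at hf ⊢
  simpa only [← map_sum, RCLike.norm_conj] using hf

theorem MeanZero.shift {f : ℕ → ℂ} (hf : MeanZero f) (k : ℕ) :
    MeanZero (fun n => f (n + k)) := by
  rw [meanZero_iff] at hf ⊢
  intro ε hε
  have hlim : Tendsto (fun N : ℕ => ε / 2 * (N : ℝ)) atTop atTop :=
    tendsto_natCast_atTop_atTop.const_mul_atTop (by positivity)
  filter_upwards [(tendsto_add_atTop_nat k).eventually (hf (ε / 2) (by positivity)),
    hlim.eventually_ge_atTop (‖∑ n ∈ Finset.range k, f n‖ + ε / 2 * k)] with N h1 h2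
  have h3 : ∑ n ∈ Finset.range N, f (n + k)
      = ∑ n ∈ Finset.range (N + k), f n - ∑ n ∈ Finset.range k, f n := by
    rw [add_comm N k, Finset.sum_range_add, add_sub_cancel_left]
    simp only [add_comm]
  rw [h3]
  have := norm_sub_le (∑ n ∈ Finset.range (N + k), f n) (∑ n ∈ Finset.range k, f n)
  push_cast at h1
  linarith

/-! ### Van der Corput's inequality -/

/-- Cauchy–Schwarz for a sum against the constant sequence `1`. -/
theorem norm_sum_range_sq_le (w : ℕ → ℂ) (N : ℕ) :
    ‖∑ n ∈ Finset.range N, w n‖ ^ 2 ≤ N * ∑ n ∈ Finset.range N, ‖w n‖ ^ 2 := by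
  calc ‖∑ n ∈ Finset.range N, w n‖ ^ 2 ≤ (∑ n ∈ Finset.range N, ‖w n‖) ^ 2 := by
        gcongr; exact norm_sum_le _ _
    _ ≤ _ := by simpa using sq_sum_le_card_mul_sum_sq (s := Finset.range N) (f := fun n => ‖w n‖)

/-- Shifting a bounded sequence by `h` changes its partial sums by at most `2 * h`. -/
theorem norm_sum_range_shift_sub_le {u : ℕ → ℂ} (hu : ∀ n, ‖u n‖ ≤ 1) (N h : ℕ) :
    ‖∑ n ∈ Finset.range N, u (n + h) - ∑ n ∈ Finset.range N, u n‖ ≤ 2 * h := by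
  have h1 : ∑ n ∈ Finset.range N, u (n + h) - ∑ n ∈ Finset.range N, u n
      = ∑ n ∈ Finset.range h, u (N + n) - ∑ n ∈ Finset.range h, u n := by
    have e1 := Finset.sum_range_add u N h
    have e2 := Finset.sum_range_add u h N
    rw [add_comm h N] at e2
    simp only [add_comm h] at e2
    linear_combination e1 - e2
  have hb : ∀ v : ℕ → ℂ, (∀ n, ‖v n‖ ≤ 1) → ‖∑ n ∈ Finset.range h, v n‖ ≤ h := fun v hv => by
    simpa using norm_sum_le_of_le (Finset.range h) (fun n _ => hv n)
  rw [h1]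
  have := norm_sub_le (∑ n ∈ Finset.range h, u (N + n)) (∑ n ∈ Finset.range h, u n)
  linarith [hb _ fun n => hu (N + n), hb u hu]

/-- **Van der Corput's difference theorem**: a bounded sequence all of whose multiplicative
derivatives have mean zero has mean zero. -/
theorem MeanZero.of_vanDerCorput {u : ℕ → ℂ} (hu : ∀ n, ‖u n‖ ≤ 1)
    (h : ∀ d : ℕ, 1 ≤ d → MeanZero (fun n => u (n + d) * (starRingEnd ℂ) (u n))) :
    MeanZero u := by
  have hoff : ∀ i j : ℕ, i ≠ j → MeanZero (fun n => u (n + i) * (starRingEnd ℂ) (u (n + j))) := by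
    have hlt : ∀ i j : ℕ, j < i →
        MeanZero (fun n => u (n + i) * (starRingEnd ℂ) (u (n + j))) := by
      intro i j hij
      have := (h (i - j) (by omega)).shift j
      refine (congrArg MeanZero (funext fun n => ?_)).mp this
      rw [show n + j + (i - j) = n + i by omega]
    intro i j hij
    rcases lt_or_gt_of_ne hij with h1 | h1
    · refine (congrArg MeanZero (funext fun n => ?_)).mp (hlt j i h1).conj
      simp [mul_comm]
    · exact hlt i j h1
  rw [meanZero_iff]
  intro ε hε
  -- `H` is the number of shifts averaged over; the bound gives `H + 1 ≤ (ε / 2 * H) ^ 2`.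
  obtain ⟨H, hH⟩ := exists_nat_gt (8 / ε ^ 2)
  have hH0 : (0 : ℝ) < H := lt_trans (by positivity) hH
  have hH1 : (1 : ℝ) ≤ H := by exact_mod_cast Nat.one_le_iff_ne_zero.2 (by rintro rfl; simp at hH0)
  set w : ℕ → ℂ := fun n => ∑ i ∈ Finset.range H, u (n + i) with hw
  have hsq : MeanZero (fun n => ∑ i ∈ Finset.range H, ∑ j ∈ (Finset.range H).erase i,
      u (n + i) * (starRingEnd ℂ) (u (n + j))) :=
    MeanZero.sum fun i _ => MeanZero.sum fun j hj => hoff i j (Finset.ne_of_mem_erase hj).symm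
  have hlim : Tendsto (fun N : ℕ => ε / 2 * (N : ℝ)) atTop atTop :=
    tendsto_natCast_atTop_atTop.const_mul_atTop (by positivity)
  filter_upwards [meanZero_iff.1 hsq 1 one_pos, hlim.eventually_ge_atTop (2 * H)] with N h1 h2
  -- The diagonal terms contribute at most `H * N`, the others at most `N`.
  have hD : ∑ n ∈ Finset.range N, ‖w n‖ ^ 2 ≤ (H + 1) * N := by
    have e : ((∑ n ∈ Finset.range N, ‖w n‖ ^ 2 : ℝ) : ℂ) =
        ∑ n ∈ Finset.range N, ∑ i ∈ Finset.range H, ((‖u (n + i)‖ ^ 2 : ℝ) : ℂ) +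
        ∑ n ∈ Finset.range N, ∑ i ∈ Finset.range H, ∑ j ∈ (Finset.range H).erase i,
          u (n + i) * (starRingEnd ℂ) (u (n + j)) := by
      rw [← Finset.sum_add_distrib]
      push_cast
      refine Finset.sum_congr rfl fun n _ => ?_
      rw [← Complex.mul_conj', hw, ← Finset.sum_add_distrib]
      simp only [map_sum, Finset.sum_mul_sum]
      refine Finset.sum_congr rfl fun i hi => ?_
      rw [← Finset.add_sum_erase _ _ hi, Complex.mul_conj']
    have hd : ‖∑ n ∈ Finset.range N, ∑ i ∈ Finset.range H, ((‖u (n + i)‖ ^ 2 : ℝ) : ℂ)‖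
        ≤ N * H := by
      have hb : ∀ n, ‖∑ i ∈ Finset.range H, ((‖u (n + i)‖ ^ 2 : ℝ) : ℂ)‖ ≤ H := fun n => by
        refine (norm_sum_le_of_le (Finset.range H) (f := fun i => ((‖u (n + i)‖ ^ 2 : ℝ) : ℂ))
          (n := fun _ => 1) fun i _ => ?_).trans (by simp)
        rw [Complex.norm_real, Real.norm_of_nonneg (by positivity)]
        exact pow_le_one₀ (norm_nonneg _) (hu _)
      exact (norm_sum_le_of_le (Finset.range N) fun n _ => hb n).trans (by simp)
    have hn : ∑ n ∈ Finset.range N, ‖w n‖ ^ 2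
        = ‖((∑ n ∈ Finset.range N, ‖w n‖ ^ 2 : ℝ) : ℂ)‖ := by
      rw [Complex.norm_real, Real.norm_of_nonneg (by positivity)]
    rw [hn, e]
    refine (norm_add_le _ _).trans ?_
    linarith
  have hCS : ‖∑ n ∈ Finset.range N, w n‖ ≤ ε / 2 * H * N := by
    refine abs_le_of_sq_le_sq' ?_ (by positivity) |>.2
    refine (norm_sum_range_sq_le w N).trans ?_
    have h3 : (H + 1 : ℝ) ≤ (ε / 2 * H) ^ 2 := by
      rw [div_lt_iff₀ (by positivity)] at hH
      nlinarith
    calc (N : ℝ) * ∑ n ∈ Finset.range N, ‖w n‖ ^ 2 ≤ N * ((H + 1) * N) := by gcongr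
      _ ≤ N * ((ε / 2 * H) ^ 2 * N) := by gcongr
      _ = _ := by ring
  have hsh : ‖∑ n ∈ Finset.range N, w n - H * ∑ n ∈ Finset.range N, u n‖ ≤ H * (2 * H) := by
    have e : ∑ n ∈ Finset.range N, w n - H * ∑ n ∈ Finset.range N, u n
        = ∑ i ∈ Finset.range H,
          (∑ n ∈ Finset.range N, u (n + i) - ∑ n ∈ Finset.range N, u n) := by
      rw [Finset.sum_sub_distrib, hw, Finset.sum_comm]
      simp
    rw [e]
    refine (norm_sum_le_of_le (Finset.range H) (n := fun _ => 2 * (H : ℝ)) fun i hi => ?_).trans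
      (by simp)
    refine (norm_sum_range_shift_sub_le hu N i).trans ?_
    have : i ≤ H := (Finset.mem_range.1 hi).le
    gcongr
  have hfin : H * ‖∑ n ∈ Finset.range N, u n‖ ≤ H * (ε * N) := by
    have e : (H : ℝ) * ‖∑ n ∈ Finset.range N, u n‖ = ‖H * ∑ n ∈ Finset.range N, u n‖ := by simp
    have := norm_sub_norm_le (H * ∑ n ∈ Finset.range N, u n) (∑ n ∈ Finset.range N, w n)
    rw [norm_sub_rev] at this
    rw [e]
    nlinarith
  exact le_of_mul_le_mul_left hfin hH0

/-! ### Phases and periodic sequences -/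

/-- The additive character `x ↦ exp (2 π i x)`. -/
noncomputable def phase (x : ℝ) : ℂ := Complex.exp (2 * Real.pi * Complex.I * (x : ℂ))

theorem phase_add (x y : ℝ) : phase (x + y) = phase x * phase y := by
  rw [phase, phase, phase, ← Complex.exp_add]; push_cast; ring_nf

@[simp] theorem norm_phase (x : ℝ) : ‖phase x‖ = 1 := by
  rw [phase, show 2 * Real.pi * Complex.I * (x : ℂ) = ((2 * Real.pi * x : ℝ) : ℂ) * Complex.I by
    push_cast; ring, Complex.norm_exp_ofReal_mul_I]

theorem phase_eq_one_iff {x : ℝ} : phase x = 1 ↔ ∃ k : ℤ, x = k := by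
  rw [phase, Complex.exp_eq_one_iff]
  refine exists_congr fun k => ?_
  rw [show (k : ℂ) * (2 * Real.pi * Complex.I) = 2 * Real.pi * Complex.I * (k : ℂ) by ring]
  rw [mul_right_inj' Complex.two_pi_I_ne_zero]
  exact_mod_cast Iff.rfl

@[simp] theorem phase_zero : phase 0 = 1 := by simp [phase]

theorem conj_phase (x : ℝ) : (starRingEnd ℂ) (phase x) = phase (-x) := by
  rw [phase, phase, ← Complex.exp_conj]; simp [map_ofNat (starRingEnd ℂ) 2]

theorem phase_pow (x : ℝ) (n : ℕ) : phase x ^ n = phase (x * n) := by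
  rw [phase, phase, ← Complex.exp_nat_mul]; push_cast; ring_nf

theorem phase_sub (x y : ℝ) : phase (x - y) = phase x * (starRingEnd ℂ) (phase y) := by
  rw [conj_phase, ← phase_add, sub_eq_add_neg]

/-- Orthogonality of the characters of `ℤ / q`. -/
theorem sum_phase_eq {q : ℕ} (hq : 0 < q) (n : ℕ) {r : ℕ} (hr : r < q) :
    ∑ j ∈ Finset.range q, phase (((n : ℝ) - r) / q * j) = if r = n % q then (q : ℂ) else 0 := by
  have hq' : (q : ℝ) ≠ 0 := by positivity
  simp only [← phase_pow]
  split_ifs with h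
  · have : phase (((n : ℝ) - r) / q) = 1 := by
      rw [phase_eq_one_iff]
      refine ⟨((n / q : ℕ) : ℤ), ?_⟩
      have := Nat.div_add_mod n q
      rw [← h] at this
      have h' : (q : ℝ) * ((n / q : ℕ) : ℝ) + r = n := by exact_mod_cast this
      rw [div_eq_iff hq', Int.cast_natCast]
      linarith
    simp [this]
  · have h1 : phase (((n : ℝ) - r) / q) ≠ 1 := by
      rw [Ne, phase_eq_one_iff]
      rintro ⟨k, hk⟩
      rw [div_eq_iff hq'] at hk
      have hk' : (n : ℤ) = r + q * k := by
        have : (n : ℝ) = r + q * k := by linarith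
        exact_mod_cast this
      apply h
      have : ((n % q : ℕ) : ℤ) = r := by
        rw [Int.natCast_mod, hk', Int.add_mul_emod_self_left]
        exact Int.emod_eq_of_lt (by positivity) (by exact_mod_cast hr)
      exact_mod_cast this.symm
    rw [geom_sum_eq h1, phase_pow, div_mul_cancel₀ _ hq']
    have : phase ((n : ℝ) - r) = 1 := phase_eq_one_iff.2 ⟨(n : ℤ) - r, by push_cast; ring⟩
    simp [this]

/-- A periodic sequence is a finite combination of rational linear phases. -/
theorem exists_eq_sum_phase_of_periodic {g : ℕ → ℂ} {q : ℕ} (hq : 0 < q)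
    (hg : Function.Periodic g q) :
    ∃ a : ℕ → ℂ, ∀ n, g n = ∑ j ∈ Finset.range q, a j * phase (((j / q : ℚ) : ℝ) * n) := by
  -- The coefficients are the finite Fourier transform of `g`.
  refine ⟨fun j => (q : ℂ)⁻¹ * ∑ r ∈ Finset.range q, g r * phase (-((j : ℝ) / q * r)),
    fun n => ?_⟩
  have hq' : (q : ℂ) ≠ 0 := by exact_mod_cast hq.ne'
  have hmem : n % q ∈ Finset.range q := Finset.mem_range.2 (Nat.mod_lt _ hq)
  calc g n = g (n % q) := (hg.map_mod_nat n).symm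
    _ = (q : ℂ)⁻¹ * ∑ r ∈ Finset.range q, g r * (if r = n % q then (q : ℂ) else 0) := by
      simp only [mul_ite, mul_zero]
      rw [Finset.sum_ite_eq' (Finset.range q) (n % q), if_pos hmem]
      field_simp
    _ = (q : ℂ)⁻¹ * ∑ r ∈ Finset.range q, g r *
          ∑ j ∈ Finset.range q, phase (((n : ℝ) - r) / q * j) := by
      congr 1
      refine Finset.sum_congr rfl fun r hr => ?_
      rw [sum_phase_eq hq n (Finset.mem_range.1 hr)]
    _ = _ := by
      simp only [Finset.mul_sum, Finset.sum_mul]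
      rw [Finset.sum_comm]
      refine Finset.sum_congr rfl fun j _ => Finset.sum_congr rfl fun r _ => ?_
      rw [show ((n : ℝ) - r) / q * j = -((j : ℝ) / q * r) + ((j / q : ℚ) : ℝ) * n by
        push_cast; ring, phase_add]
      ring

/-- If `f` is orthogonal to all rational linear phases, then it is orthogonal to all periodic
sequences. -/
theorem MeanZero.mul_periodic {f g : ℕ → ℂ} {q : ℕ} (hq : 0 < q) (hg : Function.Periodic g q)
    (hf : ∀ s : ℚ, MeanZero (fun n => f n * phase ((s : ℝ) * n))) :
    MeanZero (fun n => f n * g n) := by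
  obtain ⟨a, ha⟩ := exists_eq_sum_phase_of_periodic hq hg
  refine (congrArg MeanZero (funext fun n => ?_)).mp
    (MeanZero.sum (s := Finset.range q) fun j _ => (hf (j / q : ℚ)).const_mul (a j))
  rw [ha n, Finset.mul_sum]
  exact Finset.sum_congr rfl fun j _ => by ring

/-! ### Weyl's theorem -/

/-- The subring of rational numbers inside `ℝ`. -/
noncomputable abbrev ratSubring : Subring ℝ := (Rat.castHom ℝ).range

/-- `j` is the largest index of an irrational coefficient of `P`. -/
def IsTopIrrationalIndex (P : Polynomial ℝ) (j : ℕ) : Prop :=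
  P.coeff j ∉ ratSubring ∧ ∀ i, j < i → P.coeff i ∈ ratSubring

/-- A polynomial either has rational coefficients from index `k` on, or the largest index of an
irrational coefficient is at least `k`. -/
theorem forall_coeff_mem_or_exists_isTopIrrationalIndex (P : Polynomial ℝ) (k : ℕ) :
    (∀ i, k ≤ i → P.coeff i ∈ ratSubring) ∨ ∃ j, k ≤ j ∧ IsTopIrrationalIndex P j := by
  classical
  by_cases h : ∀ i, k ≤ i → P.coeff i ∈ ratSubring
  · exact Or.inl h
  right
  push Not at h
  obtain ⟨i, hi, hirr⟩ := h
  have hle : ∀ i, P.coeff i ∉ ratSubring → i ≤ P.natDegree := fun i hi => by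
    by_contra! hlt
    exact hi (by rw [Polynomial.coeff_eq_zero_of_natDegree_lt hlt]; exact zero_mem _)
  refine ⟨Nat.findGreatest (fun i => P.coeff i ∉ ratSubring) P.natDegree,
    hi.trans (Nat.le_findGreatest (hle i hirr) hirr),
    Nat.findGreatest_spec (P := fun i => P.coeff i ∉ ratSubring) (hle i hirr) hirr,
    fun l hl => ?_⟩
  by_contra hl'
  exact Nat.findGreatest_is_greatest hl (hle l hl') hl'

theorem IsTopIrrationalIndex.add_linear {P : Polynomial ℝ} {j : ℕ} (h : IsTopIrrationalIndex P j)
    (s : ℚ) : IsTopIrrationalIndex (P + Polynomial.C (s : ℝ) * Polynomial.X) j := by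
  have hs : ∀ i, (Polynomial.C (s : ℝ) * Polynomial.X).coeff i ∈ ratSubring := fun i => by
    rw [Polynomial.coeff_C_mul, Polynomial.coeff_X]
    refine mul_mem ⟨s, rfl⟩ ?_
    split_ifs
    exacts [one_mem _, zero_mem _]
  refine ⟨fun hm => h.1 ?_, fun i hi => ?_⟩
  · rw [Polynomial.coeff_add] at hm
    simpa using sub_mem hm (hs j)
  · rw [Polynomial.coeff_add]
    exact add_mem (h.2 i hi) (hs i)

theorem coeff_taylor_sub_self (P : Polynomial ℝ) (h : ℝ) (k : ℕ) :
    (Polynomial.taylor h P - P).coeff k = ∑ n ∈ Finset.range P.natDegree,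
      ((n + 1 + k).choose k : ℝ) * P.coeff (n + 1 + k) * h ^ (n + 1) := by
  have hd : (Polynomial.hasseDeriv k P).natDegree < P.natDegree + 1 :=
    Nat.lt_succ_of_le ((Polynomial.natDegree_hasseDeriv_le P k).trans (Nat.sub_le _ _))
  rw [Polynomial.coeff_sub, Polynomial.taylor_coeff, Polynomial.eval_eq_sum_range' hd,
    Finset.sum_range_succ']
  simp [Polynomial.hasseDeriv_coeff]

/-- Differencing lowers the top irrational index by exactly one. -/
theorem IsTopIrrationalIndex.taylor_sub_self {P : Polynomial ℝ} {j : ℕ}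
    (hP : IsTopIrrationalIndex P (j + 1)) {h : ℕ} (hh : 1 ≤ h) :
    IsTopIrrationalIndex (Polynomial.taylor (h : ℝ) P - P) j := by
  have hrat : ∀ n k : ℕ, j + 1 < n + 1 + k →
      ((n + 1 + k).choose k : ℝ) * P.coeff (n + 1 + k) * (h : ℝ) ^ (n + 1) ∈ ratSubring :=
    fun n k hnk => mul_mem (mul_mem (natCast_mem _ _) (hP.2 _ hnk))
      (pow_mem (natCast_mem _ _) _)
  refine ⟨fun hm => ?_, fun i hi => ?_⟩
  · obtain ⟨d, hd⟩ : ∃ d, P.natDegree = d + 1 := by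
      refine Nat.exists_eq_succ_of_ne_zero fun h0 => hP.1 ?_
      rw [Polynomial.coeff_eq_zero_of_natDegree_lt (by omega)]
      exact zero_mem _
    rw [coeff_taylor_sub_self, hd, Finset.sum_range_succ'] at hm
    have hrest := sum_mem (S := ratSubring) (t := Finset.range d)
      (f := fun n => ((n + 1 + 1 + j).choose j : ℝ) * P.coeff (n + 1 + 1 + j) *
        (h : ℝ) ^ (n + 1 + 1)) fun n _ => hrat (n + 1) j (by omega)
    -- Only the term `(j + 1) * h * P.coeff (j + 1)` is left, which is irrational.
    obtain ⟨r, hr⟩ := (add_mem_cancel_left hrest).1 hm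
    have hc : (0 + 1 + j).choose j = j + 1 := by
      rw [zero_add, add_comm, Nat.choose_succ_self_right]
    rw [hc, zero_add, pow_one, add_comm 1 j] at hr
    refine hP.1 ⟨r / ((j + 1) * h), ?_⟩
    have h0 : (h : ℝ) ≠ 0 := by positivity
    have hj : (j + 1 : ℝ) ≠ 0 := by positivity
    have hr' : (r : ℝ) = _ := hr
    simp only [eq_ratCast]
    push_cast at hr' ⊢
    rw [hr']
    field_simp
  · rw [coeff_taylor_sub_self]
    exact sum_mem fun n _ => hrat n i (by omega)

/-- A polynomial with rational coefficients, up to the constant one, has a periodic phase. -/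
theorem exists_periodic_phase_of_rational {P : Polynomial ℝ}
    (hP : ∀ i, 1 ≤ i → P.coeff i ∈ ratSubring) :
    ∃ q : ℕ, 0 < q ∧ Function.Periodic (fun n : ℕ => phase (P.eval (n : ℝ))) q := by
  have : ∀ i, ∃ r : ℚ, 1 ≤ i → P.coeff i = r := fun i => by
    by_cases hi : 1 ≤ i
    · obtain ⟨r, hr⟩ := hP i hi
      exact ⟨r, fun _ => hr.symm⟩
    · exact ⟨0, fun h => absurd h hi⟩
  choose r hr using this
  set D := P.natDegree + 1
  refine ⟨∏ i ∈ Finset.range D, (r i).den, Finset.prod_pos fun i _ => (r i).den_pos, fun n => ?_⟩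
  set q := ∏ i ∈ Finset.range D, (r i).den with hqdef
  have hint : P.eval ((n + q : ℕ) : ℝ) - P.eval (n : ℝ) ∈ (Int.castRingHom ℝ).range := by
    rw [Polynomial.eval_eq_sum_range, Polynomial.eval_eq_sum_range, ← Finset.sum_sub_distrib]
    refine sum_mem fun i hi => ?_
    rw [← mul_sub]
    rcases Nat.eq_zero_or_pos i with rfl | hpos
    · simp
    obtain ⟨k, hk⟩ : (q : ℤ) ∣ ((n + q : ℕ) : ℤ) ^ i - (n : ℤ) ^ i := by
      have := sub_dvd_pow_sub_pow ((n + q : ℕ) : ℤ) (n : ℤ) i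
      simpa using this
    obtain ⟨l, hl⟩ : (r i).den ∣ q := Finset.dvd_prod_of_mem _ hi
    refine ⟨(r i).num * l * k, ?_⟩
    have hk' : ((n + q : ℕ) : ℝ) ^ i - (n : ℝ) ^ i = (q : ℝ) * k := by exact_mod_cast hk
    have hnd : ((r i : ℚ) : ℝ) * ((r i).den : ℝ) = (r i).num := by
      exact_mod_cast Rat.mul_den_eq_num (r i)
    change (((r i).num * l * k : ℤ) : ℝ) = _
    rw [hk', hr i hpos, hl]
    push_cast
    linear_combination (-(l : ℝ) * k) * hnd
  obtain ⟨k, hk⟩ := hint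
  have : P.eval ((n + q : ℕ) : ℝ) = P.eval (n : ℝ) + k := by
    have : ((k : ℤ) : ℝ) = _ := hk
    rw [this]; ring
  simp only [this, phase_add, phase_eq_one_iff.2 ⟨k, rfl⟩, mul_one]

/-- If all coefficients of `P` of index at least `2` are rational, then orthogonality to `phase P`
follows from orthogonality to all linear phases that differ from the linear term of `P` by a
rational one. -/
theorem MeanZero.mul_phase_of_rational {f : ℕ → ℂ} {P : Polynomial ℝ}
    (hP : ∀ i, 2 ≤ i → P.coeff i ∈ ratSubring)
    (hf : ∀ s : ℚ, MeanZero (fun n => f n * phase ((P.coeff 1 + s) * n))) :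
    MeanZero (fun n => f n * phase (P.eval (n : ℝ))) := by
  set R := P - Polynomial.C (P.coeff 1) * Polynomial.X with hR
  obtain ⟨q, hq, hper⟩ := exists_periodic_phase_of_rational (P := R) fun i hi => by
    rw [hR, Polynomial.coeff_sub, Polynomial.coeff_C_mul, Polynomial.coeff_X]
    rcases Nat.lt_or_ge i 2 with h | h
    · obtain rfl : i = 1 := by omega
      simp
    · rw [if_neg (by omega), mul_zero, sub_zero]
      exact hP i h
  refine (congrArg MeanZero (funext fun n => ?_)).mp
    (MeanZero.mul_periodic (f := fun n => f n * phase (P.coeff 1 * n)) hq hper fun s => ?_)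
  · rw [mul_assoc, ← phase_add, hR]
    congr 2
    simp
  · refine (congrArg MeanZero (funext fun n => ?_)).mp (hf s)
    rw [mul_assoc, ← phase_add, add_mul]

theorem meanZero_phase_linear {θ : ℝ} (hθ : θ ∉ ratSubring) :
    MeanZero (fun n => phase (θ * n)) := by
  have h1 : phase θ ≠ 1 := fun h => by
    obtain ⟨k, hk⟩ := phase_eq_one_iff.1 h
    exact hθ ⟨k, by simp [hk]⟩
  have hpos : 0 < ‖phase θ - 1‖ := norm_pos_iff.2 (sub_ne_zero.2 h1)
  refine MeanZero.of_approx fun ε hε => ⟨_, MeanZero.zero, 2 / ‖phase θ - 1‖, fun N => ?_⟩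
  simp only [sub_zero, ← phase_pow]
  rw [geom_sum_eq h1, norm_div, phase_pow]
  have : ‖phase (θ * N) - 1‖ ≤ 2 := (norm_sub_le _ _).trans (by norm_num)
  have : 0 ≤ ε * N := by positivity
  have : ‖phase (θ * N) - 1‖ / ‖phase θ - 1‖ ≤ 2 / ‖phase θ - 1‖ := by gcongr
  linarith

theorem phase_eval_add_mul_conj (P : Polynomial ℝ) (n d : ℕ) :
    phase (P.eval ((n + d : ℕ) : ℝ)) * (starRingEnd ℂ) (phase (P.eval (n : ℝ)))
      = phase ((Polynomial.taylor (d : ℝ) P - P).eval (n : ℝ)) := by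
  rw [← phase_sub, Polynomial.eval_sub, Polynomial.taylor_eval]
  push_cast
  rfl

/-- **Weyl's theorem**: a polynomial phase with an irrational non-constant coefficient has mean
zero. -/
theorem meanZero_phase_polynomial {P : Polynomial ℝ} {j : ℕ} (hj : 1 ≤ j)
    (hP : IsTopIrrationalIndex P j) : MeanZero (fun n => phase (P.eval (n : ℝ))) := by
  induction j, hj using Nat.le_induction generalizing P with
  | base =>
    have := MeanZero.mul_phase_of_rational (f := fun _ => 1) (P := P)
      (fun i hi => hP.2 i (by omega)) fun s => by
        simp only [one_mul]
        refine meanZero_phase_linear fun hm => hP.1 ?_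
        simpa using sub_mem hm (⟨s, rfl⟩ : (s : ℝ) ∈ ratSubring)
    simpa using this
  | succ j hj ih =>
    refine MeanZero.of_vanDerCorput (by simp) fun d hd => ?_
    simp only [phase_eval_add_mul_conj]
    exact ih (hP.taylor_sub_self hd)

/-! ### Block-multiplicative sequences -/

theorem PlusMinusOne.mul_self (a : PlusMinusOne) : (a : ℂ) * a = 1 := by
  rcases a.2 with h | h <;> rw [h] <;> norm_num

@[simp] theorem PlusMinusOne.norm_eq_one (a : PlusMinusOne) : ‖(a : ℂ)‖ = 1 := by
  rcases a.2 with h | h <;> rw [h] <;> simp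

@[simp] theorem PlusMinusOne.conj_eq (a : PlusMinusOne) : (starRingEnd ℂ) (a : ℂ) = a := by
  rcases a.2 with h | h <;> rw [h] <;> simp

/-- On each dyadic block `[2 ^ m * a, 2 ^ m * (a + 1))` the sequence `c` is, up to a sign, one of
two words of length `2 ^ m`, and the parity of `a` determines which one. The two words are read
off from the blocks with index `0` and `1`. -/
def IsBlockMultiplicative (c : ℕ → PlusMinusOne) : Prop :=
  ∀ m a b : ℕ, b < 2 ^ m →
    (c (2 ^ m * a + b) : ℂ) = c a * c (a % 2) * c (2 ^ m * (a % 2) + b)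

/-- A sequence whose value at `2 * n + r` differs from its value at `n` by a sign depending only on
the two last binary digits is block-multiplicative. -/
theorem IsBlockMultiplicative.of_digit_recursion {c : ℕ → PlusMinusOne} (κ : ℕ → ℕ → ℂ)
    (hκ : ∀ n r, r < 2 → (c (2 * n + r) : ℂ) = c n * κ (n % 2) r) :
    IsBlockMultiplicative c := by
  intro m
  induction m with
  | zero =>
    intro a b hb
    obtain rfl : b = 0 := by simpa using hb
    simp [mul_assoc, PlusMinusOne.mul_self]
  | succ m ih =>
    intro a b hb
    have hb' : b / 2 < 2 ^ m := by rw [pow_succ] at hb; omega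
    have hr : b % 2 < 2 := Nat.mod_lt _ two_pos
    have e : ∀ x, 2 ^ (m + 1) * x + b = 2 * (2 ^ m * x + b / 2) + b % 2 := fun x => by
      have := Nat.div_add_mod b 2
      rw [pow_succ]
      linarith
    have hpar : (2 ^ m * (a % 2) + b / 2) % 2 = (2 ^ m * a + b / 2) % 2 := by
      rw [Nat.add_mod, Nat.mul_mod, Nat.mod_mod, ← Nat.mul_mod, ← Nat.add_mod]
    rw [e a, e (a % 2), hκ _ _ hr, hκ _ _ hr, ih a _ hb', hpar]
    ring

namespace IsBlockMultiplicative

variable {c : ℕ → PlusMinusOne}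

/-- The sum of `c n * z ^ n` over `N` consecutive blocks of length `2 ^ m`. -/
theorem sum_range_mul (hc : IsBlockMultiplicative c) (m N : ℕ) (z : ℂ) :
    ∑ n ∈ Finset.range (2 ^ m * N), (c n : ℂ) * z ^ n
      = ∑ a ∈ Finset.range N, c a * c (a % 2) * z ^ (2 ^ m * a) *
          ∑ b ∈ Finset.range (2 ^ m), (c (2 ^ m * (a % 2) + b) : ℂ) * z ^ b := by
  induction N with
  | zero => simp
  | succ N ih =>
    rw [Nat.mul_succ, Finset.sum_range_add, ih, Finset.sum_range_succ, Finset.mul_sum]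
    congr 1
    refine Finset.sum_congr rfl fun b hb => ?_
    rw [hc m N b (Finset.mem_range.1 hb), pow_add]
    ring

/-- Doubling the length of the words attached to the blocks `0` and `1`. -/
theorem sum_range_two_pow_succ (hc : IsBlockMultiplicative c) (m x : ℕ) (z : ℂ) :
    ∑ b ∈ Finset.range (2 ^ (m + 1)), (c (2 ^ (m + 1) * x + b) : ℂ) * z ^ b
      = c (2 * x) * c 0 * ∑ b ∈ Finset.range (2 ^ m), (c b : ℂ) * z ^ b
        + c (2 * x + 1) * c 1 * z ^ 2 ^ m *
          ∑ b ∈ Finset.range (2 ^ m), (c (2 ^ m + b) : ℂ) * z ^ b := by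
  rw [pow_succ, mul_two, Finset.sum_range_add, Finset.mul_sum, Finset.mul_sum]
  congr 1 <;> refine Finset.sum_congr rfl fun b hb => ?_
  · rw [show (2 ^ m + 2 ^ m) * x + b = 2 ^ m * (2 * x) + b by ring,
      hc m (2 * x) b (Finset.mem_range.1 hb)]
    simp [mul_assoc]
  · rw [show (2 ^ m + 2 ^ m) * x + (2 ^ m + b) = 2 ^ m * (2 * x + 1) + b by ring,
      hc m (2 * x + 1) b (Finset.mem_range.1 hb),
      show (2 * x + 1) % 2 = 1 by omega, pow_add, mul_one]
    ring

/-- If the exponential sums over the two types of dyadic blocks are small compared with the length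
of the blocks, then `c` is orthogonal to the corresponding linear phase. -/
theorem meanZero_mul_phase (hc : IsBlockMultiplicative c) (θ : ℝ)
    (h : ∀ ε : ℝ, 0 < ε → ∃ m, ∀ x < 2,
      ‖∑ b ∈ Finset.range (2 ^ m), (c (2 ^ m * x + b) : ℂ) * phase θ ^ b‖ ≤ ε * 2 ^ m) :
    MeanZero (fun n => c n * phase (θ * n)) := by
  refine MeanZero.of_approx fun ε hε => ?_
  obtain ⟨m, hm⟩ := h ε hε
  refine ⟨_, MeanZero.zero, 2 ^ m, fun N => ?_⟩
  simp only [sub_zero, ← phase_pow]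
  have hN : (2 : ℝ) ^ m * ((N / 2 ^ m : ℕ) : ℝ) ≤ N := by
    exact_mod_cast Nat.mul_div_le N (2 ^ m)
  have hr : ((N % 2 ^ m : ℕ) : ℝ) ≤ 2 ^ m := by
    exact_mod_cast (Nat.mod_lt N (by positivity)).le
  have h1 : ‖∑ n ∈ Finset.range (2 ^ m * (N / 2 ^ m)), (c n : ℂ) * phase θ ^ n‖
      ≤ (N / 2 ^ m : ℕ) * (ε * 2 ^ m) := by
    rw [hc.sum_range_mul]
    refine (norm_sum_le_of_le _ (n := fun _ => ε * 2 ^ m) fun a _ => ?_).trans (by simp)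
    simpa using hm (a % 2) (Nat.mod_lt _ two_pos)
  have h2 : ‖∑ n ∈ Finset.range (N % 2 ^ m), (c (2 ^ m * (N / 2 ^ m) + n) : ℂ) *
      phase θ ^ (2 ^ m * (N / 2 ^ m) + n)‖ ≤ (N % 2 ^ m : ℕ) :=
    (norm_sum_le_of_le _ (n := fun _ => 1) fun a _ => by simp).trans (by simp)
  calc ‖∑ n ∈ Finset.range N, (c n : ℂ) * phase θ ^ n‖
      = ‖∑ n ∈ Finset.range (2 ^ m * (N / 2 ^ m) + N % 2 ^ m), (c n : ℂ) * phase θ ^ n‖ := by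
        rw [Nat.div_add_mod]
    _ ≤ (N / 2 ^ m : ℕ) * (ε * 2 ^ m) + (N % 2 ^ m : ℕ) := by
        rw [Finset.sum_range_add]
        exact (norm_add_le _ _).trans (add_le_add h1 h2)
    _ ≤ ε * N + 2 ^ m := by nlinarith

/-- Away from the last `d` places of each dyadic block, `c (n + d) * c n` is periodic. -/
theorem mul_shift_eq (hc : IsBlockMultiplicative c) {m d n : ℕ} (h : n % 2 ^ m + d < 2 ^ m) :
    (c (n + d) : ℂ) * c n = c (n % 2 ^ (m + 1) + d) * c (n % 2 ^ (m + 1)) := by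
  have hmod : n % 2 ^ (m + 1) = 2 ^ m * (n / 2 ^ m % 2) + n % 2 ^ m := by
    rw [pow_succ, Nat.mod_mul]; ring
  have hn : n = 2 ^ m * (n / 2 ^ m) + n % 2 ^ m := (Nat.div_add_mod n _).symm
  generalize n / 2 ^ m = a at *
  generalize n % 2 ^ m = b at *
  rw [hmod, hn, add_assoc, add_assoc, hc m a b (by omega), hc m a (b + d) h]
  linear_combination (c (2 ^ m * (a % 2) + (b + d)) : ℂ) * c (2 ^ m * (a % 2) + b) *
    ((c (a % 2) : ℂ) * c (a % 2) * PlusMinusOne.mul_self (c a) +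
      PlusMinusOne.mul_self (c (a % 2)))

end IsBlockMultiplicative

/-- The number of `n < N` in the last `d` places of a block of length `M`. -/
theorem card_filter_mod_add_ge_le {M : ℕ} (hM : 0 < M) (d N : ℕ) :
    (((Finset.range N).filter fun n => ¬ n % M + d < M).card : ℝ) ≤ d * ((N + d) / M) := by
  -- Being in the last `d` places means that `M` divides `n + i` for some `i` from `1` to `d`.
  have hsub : (Finset.range N).filter (fun n => ¬ n % M + d < M) ⊆
      (Finset.Icc 1 d).biUnion fun i => (Finset.range N).filter fun n => M ∣ n + i := by
    intro n hn
    simp only [Finset.mem_filter, Finset.mem_range, Finset.mem_biUnion, Finset.mem_Icc] at hn ⊢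
    have := Nat.mod_lt n hM
    refine ⟨M - n % M, by omega, hn.1, n / M + 1, ?_⟩
    have := Nat.div_add_mod n M
    rw [mul_add]
    omega
  have hcard : ∀ i ∈ Finset.Icc 1 d,
      (((Finset.range N).filter fun n => M ∣ n + i).card : ℝ) ≤ (N + d) / M := by
    intro i hi
    rw [Finset.mem_Icc] at hi
    have h1 : ((Finset.range N).filter fun n => M ∣ n + i).card ≤ (N + d) / M := by
      rw [← Nat.Ioc_filter_dvd_card_eq_div]
      refine Finset.card_le_card_of_injOn (· + i) (fun n hn => ?_)
        (fun _ _ _ _ h => Nat.add_right_cancel h)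
      simp only [Finset.coe_filter, Finset.mem_range, Finset.mem_Ioc, Set.mem_ofPred_eq] at hn ⊢
      exact ⟨by omega, hn.2⟩
    refine (Nat.cast_le.2 h1).trans (Nat.cast_div_le.trans_eq (by push_cast; rfl))
  have h2 := (Finset.card_le_card hsub).trans Finset.card_biUnion_le
  refine (Nat.cast_le.2 h2).trans ?_
  rw [Nat.cast_sum]
  refine (Finset.sum_le_sum hcard).trans ?_
  simp

namespace IsBlockMultiplicative

variable {c : ℕ → PlusMinusOne}

/-- The correlations of a block-multiplicative sequence are limits in mean of periodic sequences,
so they are orthogonal to polynomial phases with an irrational non-constant coefficient. -/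
theorem meanZero_correlation_mul_phase (hc : IsBlockMultiplicative c) (d : ℕ) {P : Polynomial ℝ}
    {j : ℕ} (hj : 1 ≤ j) (hP : IsTopIrrationalIndex P j) :
    MeanZero (fun n => c (n + d) * c n * phase (P.eval (n : ℝ))) := by
  refine MeanZero.of_approx fun ε hε => ?_
  obtain ⟨m, hm⟩ := pow_unbounded_of_one_lt (2 * d / ε) (one_lt_two (α := ℝ))
  have h2m : (0 : ℝ) < 2 ^ m := by positivity
  set g : ℕ → ℂ := fun n => c (n % 2 ^ (m + 1) + d) * c (n % 2 ^ (m + 1)) with hg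
  have hper : Function.Periodic g (2 ^ (m + 1)) := fun n => by simp [hg]
  refine ⟨fun n => phase (P.eval (n : ℝ)) * g n,
    MeanZero.mul_periodic (by positivity) hper fun s => ?_, 2 * d * (d / 2 ^ m), fun N => ?_⟩
  · refine (congrArg MeanZero (funext fun n => ?_)).mp
      (meanZero_phase_polynomial hj (hP.add_linear s))
    rw [← phase_add]
    simp
  · have hterm : ∀ n ∈ Finset.range N,
        ‖(c (n + d) : ℂ) * c n * phase (P.eval (n : ℝ)) - phase (P.eval (n : ℝ)) * g n‖
          ≤ if ¬ n % 2 ^ m + d < 2 ^ m then 2 else 0 := by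
      intro n _
      by_cases h : n % 2 ^ m + d < 2 ^ m
      · rw [hc.mul_shift_eq h, mul_comm, sub_self, if_neg (not_not.2 h), norm_zero]
      · rw [if_pos h]
        refine (norm_sub_le _ _).trans ?_
        simp [hg]
        norm_num
    refine (norm_sum_le_of_le _ hterm).trans ?_
    rw [← Finset.sum_filter, Finset.sum_const, nsmul_eq_mul]
    have hcount := card_filter_mod_add_ge_le (M := 2 ^ m) (by positivity) d N
    push_cast at hcount
    have hdm : 2 * d / 2 ^ m ≤ ε := by
      rw [div_lt_iff₀ hε] at hm
      rw [div_le_iff₀ h2m]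
      linarith
    calc (((Finset.range N).filter fun n => ¬ n % 2 ^ m + d < 2 ^ m).card : ℝ) * 2
        ≤ d * ((N + d) / 2 ^ m) * 2 := by gcongr
      _ = 2 * d / 2 ^ m * N + 2 * d * (d / 2 ^ m) := by ring
      _ ≤ ε * N + 2 * d * (d / 2 ^ m) := by gcongr

/-- A block-multiplicative sequence orthogonal to all linear phases is orthogonal to all polynomial
phases. -/
theorem meanZero_mul_phase_polynomial (hc : IsBlockMultiplicative c)
    (hlin : ∀ θ : ℝ, MeanZero (fun n => c n * phase (θ * n))) (P : Polynomial ℝ) :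
    MeanZero (fun n => c n * phase (P.eval (n : ℝ))) := by
  rcases forall_coeff_mem_or_exists_isTopIrrationalIndex P 2 with hrat | ⟨j, hj, hP⟩
  · exact MeanZero.mul_phase_of_rational hrat fun s => hlin _
  · obtain ⟨j, rfl⟩ : ∃ i, j = i + 1 := ⟨j - 1, by omega⟩
    refine MeanZero.of_vanDerCorput (by simp) fun d hd => ?_
    refine (congrArg MeanZero (funext fun n => ?_)).mp
      (hc.meanZero_correlation_mul_phase d (by omega) (hP.taylor_sub_self hd))
    rw [← phase_eval_add_mul_conj, map_mul, PlusMinusOne.conj_eq]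
    ring

theorem isHigherOrderOscillating (hc : IsBlockMultiplicative c)
    (hlin : ∀ θ : ℝ, MeanZero (fun n => c n * phase (θ * n))) :
    IsHigherOrderOscillating (fun n => (c n : ℂ)) := by
  refine fun k _ => ⟨⟨1, le_rfl, ?_⟩, fun P _ => ?_⟩
  · simpa using Asymptotics.isBigO_refl (fun N : ℕ => (N : ℝ)) atTop
  · have h := (hc.meanZero_mul_phase_polynomial hlin P).shift 1
    refine h.congr fun N => ?_
    rw [div_eq_mul_one_div, mul_comm, Finset.range_eq_Ico,
      Finset.sum_Ico_add' (fun n => (c n : ℂ) * phase (P.eval (n : ℝ))) 0 N 1]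
    rfl

end IsBlockMultiplicative

/-! ### The Thue–Morse sequence -/

theorem coe_signPow (k : ℕ) : (signPow k : ℂ) = (-1) ^ k := rfl

theorem digits_two_mul_add {n r : ℕ} (hr : r < 2) (h : 2 * n + r ≠ 0) :
    Nat.digits 2 (2 * n + r) = r :: Nat.digits 2 n := by
  rw [Nat.digits_def' one_lt_two (Nat.pos_of_ne_zero h), show (2 * n + r) % 2 = r by omega,
    show (2 * n + r) / 2 = n by omega]

theorem thueMorse_two_mul_add (n r : ℕ) (hr : r < 2) :
    (thueMorse (2 * n + r) : ℂ) = thueMorse n * (-1) ^ r := by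
  by_cases h : 2 * n + r = 0
  · obtain ⟨rfl, rfl⟩ : n = 0 ∧ r = 0 := by omega
    simp
  · rw [thueMorse, digits_two_mul_add hr h, List.sum_cons, coe_signPow, pow_add, mul_comm]
    rfl

theorem isBlockMultiplicative_thueMorse : IsBlockMultiplicative thueMorse :=
  .of_digit_recursion (fun _ r => (-1) ^ r) thueMorse_two_mul_add

theorem thueMorse_zero : (thueMorse 0 : ℂ) = 1 := by simp [thueMorse, coe_signPow]

theorem thueMorse_one : (thueMorse 1 : ℂ) = -1 := by
  simpa [thueMorse_zero] using thueMorse_two_mul_add 0 1 one_lt_two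

/-- The square of `‖1 - w‖ ^ 2 * ‖1 + w‖` is at most `256 / 27 < (16 / 5) ^ 2` on the unit
circle. -/
theorem norm_one_sub_mul_norm_one_sub_sq_le {w : ℂ} (hw : ‖w‖ = 1) :
    ‖1 - w‖ * ‖1 - w ^ 2‖ ≤ 16 / 5 := by
  have h1 : ‖1 - w ^ 2‖ = ‖1 - w‖ * ‖1 + w‖ := by rw [← norm_mul]; ring_nf
  have hpar := parallelogram_law_with_norm ℝ (1 : ℂ) w
  rw [hw, norm_one] at hpar
  rw [h1]
  generalize ‖1 - w‖ = s at *
  generalize ‖1 + w‖ = t at *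
  refine abs_le_of_sq_le_sq' ?_ (by norm_num) |>.2
  have ht : t ^ 2 = 4 - s ^ 2 := by linarith
  have h3 : (s * (s * t)) ^ 2 = (s ^ 2) ^ 2 * (4 - s ^ 2) := by rw [← ht]; ring
  rw [h3]
  have h4 := mul_nonneg (sq_nonneg (s ^ 2 - 8 / 3)) (by positivity : 0 ≤ s ^ 2 + 4 / 3)
  nlinarith

theorem thueMorse_two_pow_add {m b : ℕ} (hb : b < 2 ^ m) :
    (thueMorse (2 ^ m + b) : ℂ) = -thueMorse b := by
  induction m generalizing b with
  | zero =>
    obtain rfl : b = 0 := by simpa using hb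
    simp [thueMorse_zero, thueMorse_one]
  | succ m ih =>
    have hb' : b / 2 < 2 ^ m := by rw [pow_succ] at hb; omega
    have hr : b % 2 < 2 := Nat.mod_lt _ two_pos
    have e : 2 ^ (m + 1) + b = 2 * (2 ^ m + b / 2) + b % 2 := by rw [pow_succ]; omega
    have e' := thueMorse_two_mul_add (b / 2) (b % 2) hr
    rw [Nat.div_add_mod] at e'
    rw [e, thueMorse_two_mul_add _ _ hr, ih hb', e']
    ring

theorem norm_sum_thueMorse_le {z : ℂ} (hz : ‖z‖ = 1) (m : ℕ) :
    ‖∑ b ∈ Finset.range (2 ^ (2 * m)), (thueMorse b : ℂ) * z ^ b‖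
      ≤ (4 / 5) ^ m * 2 ^ (2 * m) := by
  have hstep : ∀ m, ∑ b ∈ Finset.range (2 ^ (m + 1)), (thueMorse b : ℂ) * z ^ b
      = (1 - z ^ 2 ^ m) * ∑ b ∈ Finset.range (2 ^ m), (thueMorse b : ℂ) * z ^ b := fun m => by
    rw [pow_succ, mul_two, Finset.sum_range_add, sub_mul, one_mul, sub_eq_add_neg,
      ← neg_mul, Finset.mul_sum]
    congr 1
    refine Finset.sum_congr rfl fun b hb => ?_
    rw [thueMorse_two_pow_add (Finset.mem_range.1 hb), pow_add]
    ring
  induction m with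
  | zero => simp [thueMorse_zero]
  | succ m ih =>
    rw [show 2 * (m + 1) = 2 * m + 1 + 1 by ring, hstep, hstep, ← mul_assoc, norm_mul, norm_mul,
      show z ^ 2 ^ (2 * m + 1) = (z ^ 2 ^ (2 * m)) ^ 2 by rw [← pow_mul, ← pow_succ]]
    have h1 := norm_one_sub_mul_norm_one_sub_sq_le (w := z ^ 2 ^ (2 * m)) (by simp [hz])
    rw [mul_comm ‖1 - _‖] at h1
    calc _ ≤ 16 / 5 * ((4 / 5 : ℝ) ^ m * 2 ^ (2 * m)) := by gcongr
      _ = _ := by ring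

theorem meanZero_thueMorse_mul_phase (θ : ℝ) :
    MeanZero (fun n => thueMorse n * phase (θ * n)) := by
  refine isBlockMultiplicative_thueMorse.meanZero_mul_phase θ fun ε hε => ?_
  obtain ⟨m, hm⟩ := exists_pow_lt_of_lt_one hε (by norm_num : (4 / 5 : ℝ) < 1)
  have h0 : ‖∑ b ∈ Finset.range (2 ^ (2 * m)), (thueMorse b : ℂ) * phase θ ^ b‖
      ≤ ε * 2 ^ (2 * m) := by
    refine (norm_sum_thueMorse_le (norm_phase θ) m).trans ?_
    gcongr
  refine ⟨2 * m, fun x hx => ?_⟩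
  interval_cases x
  · simpa using h0
  · rw [mul_one, ← norm_neg, ← Finset.sum_neg_distrib]
    refine le_of_eq_of_le (congrArg _ (Finset.sum_congr rfl fun b hb => ?_)) h0
    rw [thueMorse_two_pow_add (Finset.mem_range.1 hb)]
    ring

/-! ### The Rudin–Shapiro sequence -/

theorem rudinShapiro_two_mul_add (n r : ℕ) (hr : r < 2) :
    (rudinShapiro (2 * n + r) : ℂ) = rudinShapiro n * (-1) ^ (n % 2 * r) := by
  by_cases h : 2 * n + r = 0
  · obtain ⟨rfl, rfl⟩ : n = 0 ∧ r = 0 := by omega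
    simp
  suffices hcount : countOneOne (2 * n + r) = countOneOne n + n % 2 * r by
    rw [rudinShapiro, hcount, coe_signPow, pow_add]
    rfl
  rw [countOneOne, countOneOne, digits_two_mul_add hr h, List.tail_cons]
  rcases Nat.eq_zero_or_pos n with rfl | hn
  · simp
  · rw [Nat.digits_def' one_lt_two hn, List.zip_cons_cons, List.tail_cons, List.count_cons]
    congr 1
    have hn2 := Nat.mod_two_eq_zero_or_one n
    interval_cases r <;> rcases hn2 with h2 | h2 <;> simp [h2]

theorem isBlockMultiplicative_rudinShapiro : IsBlockMultiplicative rudinShapiro :=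
  .of_digit_recursion (fun e r => (-1) ^ (e * r)) rudinShapiro_two_mul_add

theorem rudinShapiro_zero : (rudinShapiro 0 : ℂ) = 1 := by
  simp [rudinShapiro, countOneOne, coe_signPow]

theorem rudinShapiro_one : (rudinShapiro 1 : ℂ) = 1 := by
  simpa [rudinShapiro_zero] using rudinShapiro_two_mul_add 0 1 one_lt_two

theorem rudinShapiro_two : (rudinShapiro 2 : ℂ) = 1 := by
  simpa [rudinShapiro_one] using rudinShapiro_two_mul_add 1 0 two_pos

theorem rudinShapiro_three : (rudinShapiro 3 : ℂ) = -1 := by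
  simpa [rudinShapiro_one] using rudinShapiro_two_mul_add 1 1 one_lt_two

/-- The exponential sums over the two types of blocks satisfy the Golay–Rudin–Shapiro recursion
`P' = P + w Q`, `Q' = P - w Q`, so that the parallelogram law gives their sum of squares. -/
theorem norm_sq_add_norm_sq_rudinShapiro {z : ℂ} (hz : ‖z‖ = 1) (m : ℕ) :
    ‖∑ b ∈ Finset.range (2 ^ m), (rudinShapiro b : ℂ) * z ^ b‖ ^ 2
      + ‖∑ b ∈ Finset.range (2 ^ m), (rudinShapiro (2 ^ m + b) : ℂ) * z ^ b‖ ^ 2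
      = 2 ^ (m + 1) := by
  induction m with
  | zero => norm_num
  | succ m ih =>
    have h0 := isBlockMultiplicative_rudinShapiro.sum_range_two_pow_succ m 0 z
    have h1 := isBlockMultiplicative_rudinShapiro.sum_range_two_pow_succ m 1 z
    simp only [mul_zero, zero_add, mul_one, rudinShapiro_zero, rudinShapiro_one, rudinShapiro_two,
      one_mul, Nat.reduceAdd, rudinShapiro_three, neg_mul, ← sub_eq_add_neg] at h0 h1
    rw [h0, h1]
    generalize ∑ b ∈ Finset.range (2 ^ m), (rudinShapiro b : ℂ) * z ^ b = p at *
    generalize ∑ b ∈ Finset.range (2 ^ m), (rudinShapiro (2 ^ m + b) : ℂ) * z ^ b = q at *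
    have hpar := parallelogram_law_with_norm ℝ p (z ^ 2 ^ m * q)
    rw [norm_mul, norm_pow, hz, one_pow, one_mul] at hpar
    rw [pow_succ (2 : ℝ) (m + 1), ← ih]
    linarith

theorem meanZero_rudinShapiro_mul_phase (θ : ℝ) :
    MeanZero (fun n => rudinShapiro n * phase (θ * n)) := by
  refine isBlockMultiplicative_rudinShapiro.meanZero_mul_phase θ fun ε hε => ?_
  obtain ⟨m, hm⟩ := pow_unbounded_of_one_lt (2 / ε ^ 2) (one_lt_two (α := ℝ))
  have h := norm_sq_add_norm_sq_rudinShapiro (norm_phase θ) m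
  have hsq : (2 : ℝ) ^ (m + 1) ≤ (ε * 2 ^ m) ^ 2 := by
    rw [div_lt_iff₀ (by positivity)] at hm
    have := mul_le_mul_of_nonneg_right hm.le (by positivity : (0 : ℝ) ≤ 2 ^ m)
    calc (2 : ℝ) ^ (m + 1) = 2 * 2 ^ m := by ring
      _ ≤ _ := this
      _ = _ := by ring
  refine ⟨m, fun x hx => abs_le_of_sq_le_sq' ?_ (by positivity) |>.2⟩
  refine le_trans ?_ hsq
  rw [← h]
  interval_cases x
  · simp
  · simp

/-! ### Complexity and entropy -/

/-- The words of length `L` occurring in the sequence `c`. -/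
def wordSet {A : Type*} (c : ℕ → A) (L : ℕ) : Set (Fin L → A) :=
  Set.range fun (m : ℕ) (i : Fin L) => c (m + i)

/-- The complexity of a block-multiplicative sequence is at most linear: a word of length at most
`2 ^ m` meets at most two consecutive blocks `a`, `a + 1` of length `2 ^ m`, so it is determined by
`c a`, `c (a + 1)`, the parity of `a` and its position in the first block. -/
theorem IsBlockMultiplicative.ncard_wordSet_le {c : ℕ → PlusMinusOne}
    (hc : IsBlockMultiplicative c) {L m : ℕ} (hL : L ≤ 2 ^ m) :
    (wordSet c L).ncard ≤ 2 * Nat.card PlusMinusOne ^ 2 * 2 ^ m := by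
  have hM : 0 < 2 ^ m := by positivity
  set key : ℕ → PlusMinusOne × PlusMinusOne × Fin 2 × Fin (2 ^ m) := fun n =>
    (c (n / 2 ^ m), c (n / 2 ^ m + 1), ⟨n / 2 ^ m % 2, Nat.mod_lt _ two_pos⟩,
      ⟨n % 2 ^ m, Nat.mod_lt _ hM⟩) with hkey
  -- The word at `n` depends only on `key n`.
  set word : ℕ → Fin L → PlusMinusOne := fun n i => c (n + i) with hword
  -- The two cases are whether the place `n + i` is in the block of `n` or in the next one.
  have hval : ∀ n i, i < 2 ^ m → (c (n + i) : ℂ) =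
      if n % 2 ^ m + i < 2 ^ m then
        (c (n / 2 ^ m) : ℂ) * c (n / 2 ^ m % 2) * c (2 ^ m * (n / 2 ^ m % 2) + (n % 2 ^ m + i))
      else (c (n / 2 ^ m + 1) : ℂ) * c ((n / 2 ^ m % 2 + 1) % 2) *
        c (2 ^ m * ((n / 2 ^ m % 2 + 1) % 2) + (n % 2 ^ m + i - 2 ^ m)) := by
    intro n i hi
    have hn := Nat.div_add_mod n (2 ^ m)
    have hlt := Nat.mod_lt n hM
    split_ifs with h
    · rw [← hc m _ _ h, ← add_assoc, hn]
    · have e : (n / 2 ^ m % 2 + 1) % 2 = (n / 2 ^ m + 1) % 2 := by omega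
      rw [e, ← hc m _ _ (by omega), mul_add]
      congr 2
      omega
  have hfac : ∀ n n', key n = key n' → word n = word n' := by
    intro n n' h
    simp only [hkey, Prod.mk.injEq, Fin.mk.injEq] at h
    obtain ⟨h1, h2, h3, h4⟩ := h
    funext i
    refine Subtype.ext ?_
    have hi := i.2.trans_le hL
    simp only [hword]
    rw [hval n i hi, hval n' i hi, h1, h2, h3, h4]
  have hfac' : Function.FactorsThrough word key := fun n n' h => hfac n n' h
  have hrange : wordSet c L ⊆ Set.range (Function.extend key word fun _ => word 0) := by
    rintro _ ⟨n, rfl⟩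
    exact ⟨key n, hfac'.extend_apply _ n⟩
  refine (Set.ncard_le_ncard hrange (Set.toFinite _)).trans ?_
  rw [← Set.image_univ]
  refine (Set.ncard_image_le Set.finite_univ).trans_eq ?_
  rw [Set.ncard_univ]
  simp only [Nat.card_prod, Nat.card_fin]
  ring

open ExpGrowth ENNReal in
/-- Sequences of at most linear growth have zero exponential growth. -/
theorem expGrowthSup_le_zero_of_le_linear {u : ℕ → ENNReal} {K : ℕ}
    (hu : ∀ n : ℕ, u n ≤ K * (n + 1)) : expGrowthSup u ≤ 0 := by
  refine EReal.le_of_forall_lt_iff_le.1 fun a ha => ?_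
  have ha' : 0 < a := by exact_mod_cast ha
  rw [← expGrowthSup_exp (a := (a : EReal))]
  refine expGrowthSup_le_of_eventually_le (b := ENNReal.ofReal (K * (1 / a + 1)))
    ENNReal.ofReal_ne_top (Eventually.of_forall fun n => (hu n).trans ?_)
  rw [show (a : EReal) * (n : EReal) = ((a * n : ℝ) : EReal) by push_cast; rfl, EReal.exp_coe,
    ← ENNReal.ofReal_mul (by positivity)]
  rw [show (K : ENNReal) * (n + 1) = ENNReal.ofReal (K * (n + 1)) by
    rw [ENNReal.ofReal_mul (by positivity), ENNReal.ofReal_add (by positivity) (by positivity)]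
    simp]
  refine ENNReal.ofReal_le_ofReal ?_
  have h1 := Real.add_one_le_exp (a * n)
  have h2 : (1 / a + 1) * (a * n + 1) = (n + 1) + (1 / a + a * n) := by field_simp; ring
  have h3 : 0 ≤ 1 / a + a * n := by positivity
  have h4 : (1 / a + 1) * (a * n + 1) ≤ (1 / a + 1) * Real.exp (a * n) := by gcongr
  rw [mul_assoc]
  gcongr
  linarith

/-- A system has zero entropy if, for each entourage `U`, its orbit segments of length `n` are
determined up to `U` by one of at most linearly many words. -/
theorem topologicalEntropy_eq_zero {X : Type*} [UniformSpace X] [CompactSpace X] [Nonempty X]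
    {T : X → X} (h : ∀ U ∈ uniformity X, ∃ K : ℕ, ∀ n : ℕ, ∃ (W : Type) (φ : X → W),
      (∀ x y, φ x = φ y → ∀ k < n, (T^[k] x, T^[k] y) ∈ U) ∧
      (Set.range φ).Finite ∧ (Set.range φ).ncard ≤ K * (n + 1)) :
    topologicalEntropy T = 0 := by
  classical
  refine le_antisymm ?_ (Dynamics.coverEntropy_nonneg T Set.univ_nonempty)
  refine iSup₂_le fun U hU => ?_
  obtain ⟨K, hK⟩ := h U hU
  refine expGrowthSup_le_zero_of_le_linear (K := K) fun n => ?_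
  obtain ⟨W, φ, hφ, hfin, hcard⟩ := hK n
  have : Fintype (Set.range φ) := hfin.fintype
  -- One point for each word gives a dynamical cover.
  set s : Finset X := Finset.univ.image fun w : Set.range φ => w.2.choose with hs
  have hcover : Dynamics.IsDynCoverOf T Set.univ U n (s : Set X) := by
    intro x _
    refine ⟨(⟨φ x, x, rfl⟩ : Set.range φ).2.choose,
      Finset.mem_coe.2 (Finset.mem_image_of_mem (fun w : Set.range φ => w.2.choose)
        (Finset.mem_univ _)), ?_⟩
    rw [Dynamics.mem_dynEntourage]
    exact hφ _ _ (⟨φ x, x, rfl⟩ : Set.range φ).2.choose_spec.symm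
  have hle : s.card ≤ K * (n + 1) := by
    refine Finset.card_image_le.trans ?_
    rwa [Finset.card_univ, ← Nat.card_eq_fintype_card, Nat.card_coe_set_eq]
  have h1 : Dynamics.coverMincard T Set.univ U n ≤ ((K * (n + 1) : ℕ) : ℕ∞) :=
    hcover.coverMincard_le_card.trans (by exact_mod_cast hle)
  have h2 := ENat.toENNReal_le.2 h1
  refine h2.trans_eq ?_
  simp

/-- Agreement on a suitable finite set of coordinates implies closeness in a product space. -/
theorem exists_finset_forall_eq_imp_mem_uniformity {ι A : Type*} [UniformSpace A] {X : Set (ι → A)}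
    {U : Set (X × X)} (hU : U ∈ uniformity X) :
    ∃ I : Finset ι, ∀ x y : X, (∀ i ∈ I, x.1 i = y.1 i) → (x, y) ∈ U := by
  rw [uniformity_subtype, mem_comap] at hU
  obtain ⟨V, hV, hVU⟩ := hU
  rw [Pi.uniformity, mem_iInf] at hV
  obtain ⟨I, hI, W, hW, rfl⟩ := hV
  refine ⟨hI.toFinset, fun x y hxy => hVU ?_⟩
  simp only [Set.mem_preimage, Set.mem_iInter]
  intro i
  obtain ⟨t, ht, htW⟩ := mem_comap.1 (hW i)
  refine htW ?_
  simp only [Set.mem_preimage]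
  rw [hxy i (by simp)]
  exact refl_mem_uniformity ht

theorem IsBlockMultiplicative.exists_ncard_wordSet_le {c : ℕ → PlusMinusOne}
    (hc : IsBlockMultiplicative c) (R : ℕ) :
    ∃ K : ℕ, ∀ n, (wordSet c (n + R)).ncard ≤ K * (n + 1) := by
  refine ⟨2 * Nat.card PlusMinusOne ^ 2 * (2 * (R + 1)), fun n => ?_⟩
  obtain ⟨m, hm1, hm2⟩ : ∃ m, n + R ≤ 2 ^ m ∧ 2 ^ m ≤ 2 * (R + 1) * (n + 1) := by
    refine ⟨Nat.log 2 (n + R + 1) + 1, ?_, ?_⟩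
    · have := Nat.lt_pow_succ_log_self one_lt_two (n + R + 1)
      omega
    · rw [pow_succ]
      have := Nat.pow_log_le_self 2 (x := n + R + 1) (by omega)
      nlinarith
  refine (hc.ncard_wordSet_le hm1).trans ?_
  rw [mul_assoc _ (2 * (R + 1))]
  gcongr

theorem oneSidedShift_iterate_apply (c : ℕ → PlusMinusOne) (x : oneSidedSubshift c) (n i : ℕ) :
    ((oneSidedShift c)^[n] x).1 i = x.1 (i + n) := by
  induction n generalizing x with
  | zero => rfl
  | succ n ih =>
    rw [Function.iterate_succ_apply, ih, ← add_assoc]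
    rfl

theorem twoSidedShift_iterate_apply (c : ℕ → PlusMinusOne) (x : twoSidedSubshift c) (n : ℕ)
    (i : ℤ) : ((twoSidedShift c)^[n] x).1 i = x.1 (i + n) := by
  induction n generalizing x with
  | zero => simp
  | succ n ih =>
    rw [Function.iterate_succ_apply, ih]
    change x.1 (i + n + 1) = _
    push_cast
    rw [add_assoc]

theorem fullShiftMap_iterate_apply {A : Type*} (x : ℕ → A) (n i : ℕ) :
    fullShiftMap^[n] x i = x (i + n) := by
  induction n generalizing x with
  | zero => rfl
  | succ n ih =>
    rw [Function.iterate_succ_apply, ih, ← add_assoc]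
    rfl

/-- Every initial word of a point of the one-sided subshift occurs in `c`. -/
theorem initial_word_mem_wordSet {c : ℕ → PlusMinusOne} (x : oneSidedSubshift c) (L : ℕ) :
    (fun i : Fin L => x.1 i) ∈ wordSet c L := by
  have hcont : Continuous fun (y : ℕ → PlusMinusOne) (i : Fin L) => y i := by fun_prop
  have hclosed : IsClosed ((fun (y : ℕ → PlusMinusOne) (i : Fin L) => y i) ⁻¹' wordSet c L) :=
    (isClosed_discrete _).preimage hcont
  refine closure_minimal ?_ hclosed x.2
  rintro _ ⟨n, rfl⟩
  refine ⟨n, ?_⟩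
  funext i
  change c (n + i) = fullShiftMap^[n] c i
  rw [fullShiftMap_iterate_apply, add_comm]

theorem IsBlockMultiplicative.topologicalEntropy_oneSidedShift {c : ℕ → PlusMinusOne}
    (hc : IsBlockMultiplicative c) : topologicalEntropy (oneSidedShift c) = 0 := by
  have : Nonempty (oneSidedSubshift c) := ⟨ownPoint c⟩
  refine topologicalEntropy_eq_zero fun U hU => ?_
  obtain ⟨I, hI⟩ := exists_finset_forall_eq_imp_mem_uniformity hU
  obtain ⟨R, hR⟩ : ∃ R, ∀ i ∈ I, i < R :=
    ⟨I.sup id + 1, fun i hi => Nat.lt_succ_of_le (Finset.le_sup (f := id) hi)⟩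
  obtain ⟨K, hK⟩ := hc.exists_ncard_wordSet_le R
  refine ⟨K, fun n => ⟨Fin (n + R) → PlusMinusOne, fun x i => x.1 i, ?_, Set.toFinite _, ?_⟩⟩
  · intro x y hxy k hk
    refine hI _ _ fun i hi => ?_
    rw [oneSidedShift_iterate_apply, oneSidedShift_iterate_apply]
    exact congrFun hxy ⟨i + k, by have := hR i hi; omega⟩
  · refine (Set.ncard_le_ncard ?_ (Set.toFinite _)).trans (hK n)
    rintro _ ⟨x, rfl⟩
    exact initial_word_mem_wordSet x _

theorem IsBlockMultiplicative.topologicalEntropy_twoSidedShift {c : ℕ → PlusMinusOne}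
    (hc : IsBlockMultiplicative c) [Nonempty (twoSidedSubshift c)] :
    topologicalEntropy (twoSidedShift c) = 0 := by
  refine topologicalEntropy_eq_zero fun U hU => ?_
  obtain ⟨I, hI⟩ := exists_finset_forall_eq_imp_mem_uniformity hU
  obtain ⟨R, hR⟩ : ∃ R : ℕ, ∀ i ∈ I, i.natAbs < R :=
    ⟨I.sup Int.natAbs + 1, fun i hi => Nat.lt_succ_of_le (Finset.le_sup (f := Int.natAbs) hi)⟩
  obtain ⟨K, hK⟩ := hc.exists_ncard_wordSet_le (2 * R)
  refine ⟨K, fun n => ⟨Fin (n + 2 * R) → PlusMinusOne,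
    fun x i => x.1 (-(R : ℤ) + ((i : ℕ) : ℤ)), ?_, Set.toFinite _, ?_⟩⟩
  · intro x y hxy k hk
    refine hI _ _ fun i hi => ?_
    have hiR := hR i hi
    have e : i + (k : ℤ) = -(R : ℤ) + ((i + k + R).toNat : ℤ) := by omega
    rw [twoSidedShift_iterate_apply, twoSidedShift_iterate_apply, e]
    exact congrFun hxy ⟨(i + k + R).toNat, by omega⟩
  · refine (Set.ncard_le_ncard ?_ (Set.toFinite _)).trans (hK n)
    rintro _ ⟨x, rfl⟩
    obtain ⟨m, hm⟩ := x.2 (-(R : ℤ)) (n + 2 * R)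
    exact ⟨m, funext fun i => (hm i i.2).symm⟩

/-! ### Two-sided extension and self-correlation -/

/-- A recurrent sequence extends to the left: if every initial word of `c` occurs in `c`
arbitrarily far to the right, then `c` is the nonnegative half of a point of its two-sided
subshift. -/
theorem exists_twoSided_extension_of_recurrent {c : ℕ → PlusMinusOne} (p : ℕ → ℕ)
    (hp : ∀ m, m ≤ p m) (hc : ∀ m b, b < m → c (p m + b) = c b) :
    ∃ y : twoSidedSubshift c, ∀ n : ℕ, y.1 (n : ℤ) = c n := by
  obtain ⟨y, hy⟩ : ∃ y, MapClusterPt y atTop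
      (fun (m : ℕ) (j : ℤ) => c ((p m : ℤ) + j).toNat) := exists_clusterPt_of_compactSpace _
  have hfreq : ∀ (I : Finset ℤ) (M : ℕ), ∃ m, M ≤ m ∧
      ∀ i ∈ I, y i = c ((p m : ℤ) + i).toNat := by
    intro I M
    have hn : (I : Set ℤ).pi (fun i => {y i}) ∈ 𝓝 y :=
      set_pi_mem_nhds I.finite_toSet fun i _ => mem_nhds_discrete.2 rfl
    obtain ⟨m, hm, hm'⟩ := ((hy.frequently hn).and_eventually (eventually_ge_atTop M)).exists
    exact ⟨m, hm', fun i hi => (hm i hi).symm⟩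
  refine ⟨⟨y, fun a L => ?_⟩, fun n => ?_⟩
  · obtain ⟨m, hm, h⟩ := hfreq ((Finset.range L).image fun i : ℕ => a + (i : ℤ)) a.natAbs
    refine ⟨((p m : ℤ) + a).toNat, fun i hi => ?_⟩
    rw [h _ (Finset.mem_image_of_mem _ (Finset.mem_range.2 hi))]
    have := hp m
    congr 1
    omega
  · obtain ⟨m, hm, h⟩ := hfreq {(n : ℤ)} (n + 1)
    change y n = c n
    rw [h _ (Finset.mem_singleton_self _), ← hc m n (by omega)]
    congr 1

theorem IsBlockMultiplicative.exists_twoSided_extension {c : ℕ → PlusMinusOne}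
    (hc : IsBlockMultiplicative c) (h0 : (c 0 : ℂ) = 1) (h10 : (c 10 : ℂ) = 1) :
    ∃ y : twoSidedSubshift c, ∀ n : ℕ, y.1 (n : ℤ) = c n := by
  -- The block of length `2 ^ m` with index `10` repeats the initial word of `c`.
  refine exists_twoSided_extension_of_recurrent (fun m => 2 ^ m * 10) (fun m => ?_)
    fun m b hb => ?_
  · have := (Nat.lt_two_pow_self (n := m)).le
    omega
  · refine Subtype.ext ?_
    have := hc m 10 b (hb.trans Nat.lt_two_pow_self)
    simpa [h0, h10] using this

/-- A sequence of signs correlates perfectly with an observable that reproduces it along an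
orbit. -/
theorem tendsto_correlationAverage_one {c : ℕ → PlusMinusOne} {X : Type*} {T : X → X} {f : X → ℂ}
    {x : X} (h : ∀ n, f (T^[n] x) = c n) :
    Tendsto (correlationAverage (fun n => (c n : ℂ)) T f x) atTop (𝓝 1) := by
  refine tendsto_const_nhds.congr' ?_
  filter_upwards [eventually_ne_atTop 0] with N hN
  have hN' : (N : ℂ) ≠ 0 := Nat.cast_ne_zero.2 hN
  simp [correlationAverage, h, PlusMinusOne.mul_self, hN']

theorem not_isOrthogonalToSystem_of_tendsto_one {c : ℕ → ℂ} {X : Type*} [TopologicalSpace X]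
    {T : X → X} {f : X → ℂ} (hf : Continuous f) {x : X}
    (h : Tendsto (correlationAverage c T f x) atTop (𝓝 1)) : ¬ IsOrthogonalToSystem c T :=
  fun horth => one_ne_zero (tendsto_nhds_unique h (horth ⟨f, hf⟩ x))

/-- The value `1` at `0` and `10` serves only to extend `c` to a two-sided sequence. -/
theorem IsBlockMultiplicative.oscillating_and_self_correlated {c : ℕ → PlusMinusOne}
    (hc : IsBlockMultiplicative c) (h0 : (c 0 : ℂ) = 1) (h10 : (c 10 : ℂ) = 1)
    (hlin : ∀ θ : ℝ, MeanZero (fun n => c n * phase (θ * n))) :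
      IsHigherOrderOscillating (fun n => (c n : ℂ)) ∧
      (topologicalEntropy (twoSidedShift c) = 0 ∧
        ¬ IsOrthogonalToSystem (fun n => (c n : ℂ)) (twoSidedShift c) ∧
        ∃ y : twoSidedSubshift c, (∀ n : ℕ, y.1 (n : ℤ) = c n) ∧
          Tendsto (correlationAverage (fun n => (c n : ℂ)) (twoSidedShift c)
            (fun x => (x.1 0 : ℂ)) y) atTop (𝓝 1)) ∧
      (topologicalEntropy (oneSidedShift c) = 0 ∧
        ¬ IsOrthogonalToSystem (fun n => (c n : ℂ)) (oneSidedShift c) ∧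
        Tendsto (correlationAverage (fun n => (c n : ℂ)) (oneSidedShift c)
          (fun x => (x.1 0 : ℂ)) (ownPoint c)) atTop (𝓝 1)) := by
  obtain ⟨y, hy⟩ := hc.exists_twoSided_extension h0 h10
  have : Nonempty (twoSidedSubshift c) := ⟨y⟩
  have htwo : Tendsto (correlationAverage (fun n => (c n : ℂ)) (twoSidedShift c)
      (fun x => (x.1 0 : ℂ)) y) atTop (𝓝 1) :=
    tendsto_correlationAverage_one fun n => by
      rw [twoSidedShift_iterate_apply, zero_add, hy]
  have hone : Tendsto (correlationAverage (fun n => (c n : ℂ)) (oneSidedShift c)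
      (fun x => (x.1 0 : ℂ)) (ownPoint c)) atTop (𝓝 1) :=
    tendsto_correlationAverage_one fun n => by
      rw [oneSidedShift_iterate_apply, zero_add]
      rfl
  refine ⟨hc.isHigherOrderOscillating hlin, ⟨hc.topologicalEntropy_twoSidedShift,
    not_isOrthogonalToSystem_of_tendsto_one ?_ htwo, y, hy, htwo⟩,
    hc.topologicalEntropy_oneSidedShift, not_isOrthogonalToSystem_of_tendsto_one ?_ hone, hone⟩
  · exact continuous_subtype_val.comp ((continuous_apply _).comp continuous_subtype_val)
  · exact continuous_subtype_val.comp ((continuous_apply _).comp continuous_subtype_val)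

theorem thueMorse_ten : (thueMorse 10 : ℂ) = 1 := by simp [thueMorse, coe_signPow]

theorem rudinShapiro_ten : (rudinShapiro 10 : ℂ) = 1 := by
  have h5 := rudinShapiro_two_mul_add 2 1 one_lt_two
  have h10 := rudinShapiro_two_mul_add 5 0 two_pos
  norm_num [rudinShapiro_two] at h5 h10
  rw [h10, h5]

theorem mainTheorem1 :
    (∃ (X : Type) (_ : UniformSpace X) (_ : CompactSpace X) (_ : T2Space X) (T : X ≃ₜ X)
      (c : ℕ → ℂ), topologicalEntropy T = 0 ∧ IsHigherOrderOscillating c ∧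
        ¬ IsOrthogonalToSystem c T) ∧
    ∀ c : ℕ → PlusMinusOne, c = thueMorse ∨ c = rudinShapiro →
      IsHigherOrderOscillating (fun n => (c n : ℂ)) ∧
      (topologicalEntropy (twoSidedShift c) = 0 ∧
        ¬ IsOrthogonalToSystem (fun n => (c n : ℂ)) (twoSidedShift c) ∧
        ∃ y : twoSidedSubshift c, (∀ n : ℕ, y.1 (n : ℤ) = c n) ∧
          Tendsto (correlationAverage (fun n => (c n : ℂ)) (twoSidedShift c)
            (fun x => (x.1 0 : ℂ)) y) atTop (𝓝 1)) ∧
      (topologicalEntropy (oneSidedShift c) = 0 ∧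
        ¬ IsOrthogonalToSystem (fun n => (c n : ℂ)) (oneSidedShift c) ∧
        Tendsto (correlationAverage (fun n => (c n : ℂ)) (oneSidedShift c)
          (fun x => (x.1 0 : ℂ)) (ownPoint c)) atTop (𝓝 1)) := by
  refine (and_iff_right_of_imp fun key => ?_).2 ?_
  · obtain ⟨hosc, ⟨hent, horth, _⟩, _⟩ := key thueMorse (Or.inl rfl)
    exact ⟨twoSidedSubshift thueMorse, inferInstance, inferInstance, inferInstance,
      twoSidedShift thueMorse, _, hent, hosc, horth⟩
  · rintro c (rfl | rfl)
    · exact isBlockMultiplicative_thueMorse.oscillating_and_self_correlated thueMorse_zero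
        thueMorse_ten meanZero_thueMorse_mul_phase
    · exact isBlockMultiplicative_rudinShapiro.oscillating_and_self_correlated rudinShapiro_zero
        rudinShapiro_ten meanZero_rudinShapiro_mul_phase
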